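/- An algebraic formula over $\mathbb{C}$ is a rooted tree whose leaves are labelled by variables or complex constants and whose inner nodes are $+$ or $\times$ gates of arbitrary positive fan-in; the edges entering a $+$ gate carry complex constants, so that the gate computes a linear combination of its children. The size of a formula is its number of nodes, and its depth is the length of a longest root-to-leaf path. For a sequence $\lambda=(\lambda_1,\dots,\lambda_\ell)$ of natural numbers put $\lambda_j=0$ for $j>\ell$, and for $n\ge \ell$ consider the generalized Vandermonde determinant $$a_{\lambda+\delta}(x_1,\dots,x_n)=\det\bigl(x_i^{\lambda_j+n-j}\bigr)_{1\le i,j\le n}\in\mathbb{C}[x_1,\dots,x_n].$$ Call $(\lambda,n)$ with $\ell\ge 1$ admissible if $\lambda_i\ge\lambda_{i+1}+(\ell-1)$ for all $1\le i\le \ell-1$, $\lambda_\ell\ge \ell$, and $n\ge\lambda_1+\ell$. Let $\det_\ell$ be the determinant of an $\ell\times\ell$ matrix of $\ell^2$ independent variables. (1) There are a polynomial $p$ with natural-number coefficients and a constant $c\in\mathbb{N}$ such that, for every $\ell \ge 1$, every admissible $(\lambda,n)$ with $\lambda=(\lambda_1,\dots,\lambda_\ell)$, and all $s,\Delta\in\mathbb{N}$: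 if $a_{\lambda+\delta}(x_1,\dots,x_n)$ has an algebraic formula of size at most $s$ and depth at most $\Delta$, then $\det_\ell$ has an algebraic formula of size at most $p(s)$ and depth at most $\Delta+c$. (2) Such exponents can be taken polynomially large: there is a polynomial $q$ with natural-number coefficients such that for every $\ell\ge1$ there is an admissible $(\lambda,n)$ with $\lambda=(\lambda_1,\dots,\lambda_\ell)$, with $n\le q(\ell)$ and all exponents $\lambda_j+n-j$ $(1\le j\le n)$ at most $q(\ell)$. -/

import Mathlib

/-- Algebraic formulas over the field `K` in the variables `σ`: rooted trees whose leaves are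
labelled by variables or field constants and whose inner nodes are sum gates or product gates of
arbitrary fan-in `k + 1 ≥ 1`. The edges entering a sum gate carry field constants, so that a sum
gate computes a linear combination of its children. -/
inductive AlgFormula (K : Type) (σ : Type) : Type
  | var (x : σ) : AlgFormula K σ
  | const (a : K) : AlgFormula K σ
  | sum (k : ℕ) (c : Fin (k + 1) → K) (f : Fin (k + 1) → AlgFormula K σ) : AlgFormula K σ
  | prod (k : ℕ) (f : Fin (k + 1) → AlgFormula K σ) : AlgFormula K σ

namespace AlgFormula

/-- The polynomial computed by a formula. -/
noncomputable def toPoly {K σ : Type} [Field K] : AlgFormula K σ → MvPolynomial σ K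
  | var x => MvPolynomial.X x
  | const a => MvPolynomial.C a
  | sum _ c f => ∑ i, MvPolynomial.C (c i) * (f i).toPoly
  | prod _ f => ∏ i, (f i).toPoly

/-- The size of a formula: the number of nodes of the tree, leaves included. -/
def size {K σ : Type} : AlgFormula K σ → ℕ
  | var _ => 1
  | const _ => 1
  | sum _ _ f => 1 + ∑ i, (f i).size
  | prod _ f => 1 + ∑ i, (f i).size

/-- The depth of a formula: the number of edges on a longest path from the root to a leaf. -/
def depth {K σ : Type} : AlgFormula K σ → ℕ
  | var _ => 0
  | const _ => 0
  | sum _ _ f => 1 + Finset.univ.sup fun i => (f i).depth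
  | prod _ f => 1 + Finset.univ.sup fun i => (f i).depth

end AlgFormula

/-- `P` is computed by a single algebraic formula of size at most `s` and depth at most `Δ`. -/
def HasFormula {K σ : Type} [Field K] (P : MvPolynomial σ K) (s Δ : ℕ) : Prop :=
  ∃ F : AlgFormula K σ, F.toPoly = P ∧ F.size ≤ s ∧ F.depth ≤ Δ

/-- The generalized Vandermonde determinant `det (x_i ^ μ_j)` in the variables `x_1, …, x_n`. -/
noncomputable def genVandermondeDet {n : ℕ} (μ : Fin n → ℕ) : MvPolynomial (Fin n) ℂ :=
  Matrix.det (Matrix.of fun i j : Fin n => (MvPolynomial.X i : MvPolynomial (Fin n) ℂ) ^ μ j)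

/-- The exponent vector `λ + δ`, where `λ = (λ_1, …, λ_ℓ)` is padded with zeros to length `n` and
`δ = (n - 1, …, 1, 0)`. Indices start at `0` here, so that the entry `λ_j + n - j` of the usual
numbering sits at the index `j - 1`. -/
def shiftedExponents {ℓ : ℕ} (n : ℕ) (lam : Fin ℓ → ℕ) (j : Fin n) : ℕ :=
  (if h : (j : ℕ) < ℓ then lam ⟨j, h⟩ else 0) + (n - 1 - (j : ℕ))

/-- The condition on `λ = (λ_1, …, λ_ℓ)` and the number `n` of variables: `ℓ ≥ 1`,
`λ_i ≥ λ_{i+1} + (ℓ - 1)` for `1 ≤ i ≤ ℓ - 1`, `λ_ℓ ≥ ℓ`, and `n ≥ λ_1 + ℓ`. -/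
def Admissible {ℓ : ℕ} (n : ℕ) (lam : Fin ℓ → ℕ) : Prop :=
  0 < ℓ ∧
  (∀ i j : Fin ℓ, (j : ℕ) = (i : ℕ) + 1 → lam j + (ℓ - 1) ≤ lam i) ∧
  (∀ i : Fin ℓ, (i : ℕ) + 1 = ℓ → ℓ ≤ lam i) ∧
  (∀ i : Fin ℓ, (i : ℕ) = 0 → lam i + ℓ ≤ n)

/-- The symbolic `ℓ × ℓ` determinant, a polynomial in `ℓ ^ 2` independent variables. -/
noncomputable def symbolicDet (ℓ : ℕ) : MvPolynomial (Fin ℓ × Fin ℓ) ℂ :=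
  (Matrix.mvPolynomialX (Fin ℓ) (Fin ℓ) ℂ).det

/-! With `n = ℓ + m`, the exponents `λ + δ` are `k b + n` for `ℓ` values `k b < m`, together with
all of `m - 1, …, 0`. Substitute `x_i = z_i (1 + t L_i)`, with `z_i` the `n`-th roots of unity and
`L_i` linear forms in the `y_{a b}`. Subtracting column `k b` from column `k b + n` leaves `x_i ^ k
b * (x_i ^ n - 1)`, divisible by `t`; so the determinant is divisible by `t ^ ℓ`, and its
coefficient there is linear in the `L_i` in each of `ℓ` columns. The `L_i` are chosen so that, in
the Fourier basis, this coefficient is a nonzero multiple of `det_ℓ` (`det_perturbation_columns`,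
`coeff_det_perturbed`). The coefficient of `t ^ ℓ` is a linear combination of values at `t = 0, …,
s`, since formula size bounds degree. Each value costs one affine form per leaf, and one sum gate
combines them. -/

/-! ### The determinant to first order at roots of unity -/

open Matrix in
/-- Subtracting the column of exponent `k b` from the column of exponent `k b + N` does not change
the generalized Vandermonde determinant. -/
theorem det_pow_eq_det_pow_mul_pow_sub_one {R : Type*} [CommRing R] {ℓ m : ℕ} (N : ℕ)
    (x : Fin ℓ ⊕ Fin m → R) (k : Fin ℓ → Fin m) :
    (Matrix.of fun i j => x i ^ Sum.elim (fun b => (k b : ℕ) + N) (fun b => (b.rev : ℕ)) j).det =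
      (Matrix.of fun i j => Sum.elim (fun b => x i ^ (k b : ℕ) * (x i ^ N - 1))
        (fun b => x i ^ (b.rev : ℕ)) j).det := by
  let U : Matrix (Fin ℓ ⊕ Fin m) (Fin ℓ ⊕ Fin m) R :=
    -- Column `inr c` has exponent `c.rev`, so `(k b).rev` selects exponent `k b`.
    fromBlocks 1 0 (Matrix.of fun c b => if c = (k b).rev then 1 else 0) 1
  have hU : U.det = 1 := by simp [U]
  have hmul : ∀ T : Matrix (Fin ℓ ⊕ Fin m) (Fin ℓ ⊕ Fin m) R, (T * U).det = T.det := fun T => by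
    rw [det_mul, hU, mul_one]
  refine Eq.trans (congrArg det ?_) (hmul _)
  ext i j
  rw [Matrix.mul_apply, Fintype.sum_sum_type]
  rcases j with b | b
  · simp only [U, of_apply, Sum.elim_inl, Sum.elim_inr, fromBlocks_apply₁₁, fromBlocks_apply₂₁,
      Matrix.one_apply, mul_ite, mul_one, mul_zero, Finset.sum_ite_eq', Finset.mem_univ, if_true,
      Fin.rev_rev, pow_add]
    ring
  · simp [U, Matrix.one_apply]

/-- The linear form whose coefficient at `y_{a b}` is `z ^ (ℓ + m - 1 - a - k_b)`. -/
noncomputable def perturbation {ℓ m : ℕ} (k : Fin ℓ → Fin m) (z : ℂ) :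
    MvPolynomial (Fin ℓ × Fin ℓ) ℂ :=
  ∑ p : Fin ℓ × Fin ℓ, MvPolynomial.C (z ^ (ℓ + m - 1 - p.1 - k p.2)) * MvPolynomial.X p

open Matrix in
-- Expand every column in the powers `z ^ 0, …, z ^ (n - 1)`, `n = ℓ + m`. The right columns are the
-- powers below `m`, so only the coefficients of the `ℓ` top powers matter in the left ones; up to
-- the factor `n` these form the generic matrix.
theorem det_perturbation_columns {ℓ m : ℕ} (k : Fin ℓ → Fin m)
    (hk : Function.Injective fun p : Fin ℓ × Fin ℓ => (p.1 : ℕ) + k p.2)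
    (z : Fin ℓ ⊕ Fin m → ℂ) (hz : Function.Injective z) (hzn : ∀ i, z i ^ (ℓ + m) = 1) :
    ∃ v : ℂ, v ≠ 0 ∧
      (Matrix.of fun i j => Sum.elim
        (fun b => MvPolynomial.C (z i ^ (k b : ℕ)) *
          (perturbation k (z i) * ((ℓ + m : ℕ) : MvPolynomial (Fin ℓ × Fin ℓ) ℂ)))
        (fun b : Fin m => MvPolynomial.C (z i ^ (b.rev : ℕ))) j).det =
      MvPolynomial.C v * symbolicDet ℓ := by
  rcases Nat.eq_zero_or_pos (ℓ + m) with h0 | hn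
  · obtain ⟨rfl, rfl⟩ : ℓ = 0 ∧ m = 0 := by omega
    exact ⟨1, one_ne_zero, by simp [symbolicDet]⟩
  let ρ : Fin ℓ ⊕ Fin m → ℕ := fun i => ((finSumFinEquiv i).rev : ℕ)
  let τ : ℕ → Fin ℓ ⊕ Fin m := fun e =>
    finSumFinEquiv.symm (Fin.rev ⟨e % (ℓ + m), Nat.mod_lt _ hn⟩)
  have hρτ : ∀ e, ρ (τ e) = e % (ℓ + m) := fun e => by simp only [ρ, τ]; simp
  let W : Matrix (Fin ℓ ⊕ Fin m) (Fin ℓ ⊕ Fin m) ℂ := Matrix.of fun i j => z i ^ ρ j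
  have hW : W.det ≠ 0 := by
    have : W = (projVandermonde (fun _ => 1) (z ∘ finSumFinEquiv.symm)).submatrix
        finSumFinEquiv finSumFinEquiv := by
      ext i j
      simp only [W, ρ, projVandermonde_apply, submatrix_apply, of_apply, Function.comp,
        one_pow, one_mul, Equiv.symm_apply_apply]
    rw [this, det_submatrix_equiv_self, det_projVandermonde, Finset.prod_ne_zero_iff]
    refine fun i _ => Finset.prod_ne_zero_iff.2 fun j hj => ?_
    rw [one_mul, one_mul, sub_ne_zero]
    exact fun h => (Finset.mem_Ioi.1 hj).ne (finSumFinEquiv.symm.injective (hz h))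
  let Y : Matrix (Fin ℓ) (Fin ℓ) (MvPolynomial (Fin ℓ × Fin ℓ) ℂ) :=
    mvPolynomialX (Fin ℓ) (Fin ℓ) ℂ
  let e : Fin ℓ → Fin ℓ × Fin ℓ → ℕ := fun b p => k b + (ℓ + m - 1 - p.1 - k p.2)
  let B : Matrix (Fin m) (Fin ℓ) (MvPolynomial (Fin ℓ × Fin ℓ) ℂ) :=
    Matrix.of fun c b => ((ℓ + m : ℕ) : MvPolynomial (Fin ℓ × Fin ℓ) ℂ) *
      ∑ p, if τ (e b p) = Sum.inr c then MvPolynomial.X p else 0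
  -- The exponent is `n - 1 - a` modulo `n` iff `a + k b` and `p.1 + k p.2` are congruent; both are
  -- below `n`, hence equal, and `hk` applies.
  have hτ : ∀ b p a, τ (e b p) = Sum.inl a ↔ p = (a, b) := by
    intro b p a
    have hρ : Function.Injective ρ := fun i j h =>
      finSumFinEquiv.injective (Fin.rev_injective (Fin.ext h))
    rw [← hρ.eq_iff, hρτ]
    have hρa : ρ (Sum.inl a) = ℓ + m - 1 - a := by
      simp only [ρ, finSumFinEquiv_apply_left, Fin.val_rev, Fin.val_castAdd]
      omega
    have hp := p.1.isLt
    have hkp := (k p.2).isLt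
    have hkb := (k b).isLt
    have ha := a.isLt
    rw [hρa, ← hk.eq_iff]
    simp only [e]
    rcases lt_or_ge (k b + (ℓ + m - 1 - p.1 - k p.2) : ℕ) (ℓ + m) with h | h
    · rw [Nat.mod_eq_of_lt h]
      omega
    · rw [Nat.mod_eq_sub_mod h, Nat.mod_eq_of_lt (by omega)]
      omega
  refine ⟨W.det * ((ℓ + m : ℕ) : ℂ) ^ ℓ,
    mul_ne_zero hW (pow_ne_zero _ (by exact_mod_cast hn.ne')), ?_⟩
  let T : Matrix (Fin ℓ ⊕ Fin m) (Fin ℓ ⊕ Fin m) (MvPolynomial (Fin ℓ × Fin ℓ) ℂ) :=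
    fromBlocks (((ℓ + m : ℕ) : MvPolynomial (Fin ℓ × Fin ℓ) ℂ) • Y) 0 B 1
  have key : (Matrix.of fun i j => Sum.elim
        (fun b => MvPolynomial.C (z i ^ (k b : ℕ)) *
          (perturbation k (z i) * ((ℓ + m : ℕ) : MvPolynomial (Fin ℓ × Fin ℓ) ℂ)))
        (fun b : Fin m => MvPolynomial.C (z i ^ (b.rev : ℕ))) j) =
      W.map (MvPolynomial.C : ℂ →+* MvPolynomial (Fin ℓ × Fin ℓ) ℂ) * T := by
    ext1 i j
    rcases j with b | b
    · have hentry : ∀ a', T a' (Sum.inl b) = ((ℓ + m : ℕ) : MvPolynomial (Fin ℓ × Fin ℓ) ℂ) *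
            ∑ p, if τ (e b p) = a' then MvPolynomial.X p else 0 := by
        rintro (a | c)
        · simp [hτ, T, Y]
        · rfl
      have hpow : ∀ p, z i ^ ρ (τ (e b p)) = z i ^ (e b p) := fun p => by
        rw [hρτ, ← pow_mod_orderOf, Nat.mod_mod_of_dvd _ (orderOf_dvd_of_pow_eq_one (hzn i)),
          pow_mod_orderOf]
      rw [Matrix.mul_apply]
      simp only [hentry, of_apply, Sum.elim_inl, Matrix.map_apply, perturbation, W, Finset.mul_sum,
        Finset.sum_mul]
      rw [Finset.sum_comm]
      refine Finset.sum_congr rfl fun p _ => ?_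
      simp only [mul_ite, mul_zero, Finset.sum_ite_eq, Finset.mem_univ, if_true, hpow]
      simp only [e, pow_add, map_mul]
      ring
    · rw [Matrix.mul_apply, Fintype.sum_sum_type]
      have hρb : ρ (Sum.inr b) = b.rev := by
        simp only [ρ, finSumFinEquiv_apply_right, Fin.val_rev, Fin.val_natAdd]
        omega
      simp [Matrix.one_apply, W, T, hρb]
  rw [key, det_mul, show T = _ from rfl, det_fromBlocks_zero₁₂, det_one, mul_one, det_smul,
    ← RingHom.mapMatrix_apply,
    ← RingHom.map_det, symbolicDet]
  simp [Y]
  ring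

/-! ### Substitution, degree and affine forms for formulas -/

namespace AlgFormula

variable {K σ τ : Type}

/-- Replace every variable leaf of a formula by a formula. -/
def subst (g : σ → AlgFormula K τ) : AlgFormula K σ → AlgFormula K τ
  | var x => g x
  | const a => const a
  | sum k c f => sum k c fun i => (f i).subst g
  | prod k f => prod k fun i => (f i).subst g

theorem toPoly_subst [Field K] (g : σ → AlgFormula K τ) (F : AlgFormula K σ) :
    (F.subst g).toPoly = MvPolynomial.aeval (fun x => (g x).toPoly) F.toPoly := by
  induction F with
  | var x => simp [subst, toPoly]
  | const a => simp [subst, toPoly]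
  | sum k c f ih => simp [subst, toPoly, ih]
  | prod k f ih => simp [subst, toPoly, ih]

theorem size_subst_le (g : σ → AlgFormula K τ) {t : ℕ} (ht : 1 ≤ t) (hg : ∀ x, (g x).size ≤ t)
    (F : AlgFormula K σ) : (F.subst g).size ≤ F.size * t := by
  induction F with
  | var x => simpa [subst, size] using hg x
  | const a => simpa [subst, size] using ht
  | sum k c f ih | prod k f ih =>
    simp only [subst, size, add_mul, Finset.sum_mul, one_mul]
    exact add_le_add ht (Finset.sum_le_sum fun i _ => ih i)

theorem depth_subst_le (g : σ → AlgFormula K τ) {d : ℕ} (hg : ∀ x, (g x).depth ≤ d)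
    (F : AlgFormula K σ) : (F.subst g).depth ≤ F.depth + d := by
  induction F with
  | var x => simpa [subst, depth] using hg x
  | const a => simp [subst, depth]
  | sum k c f ih | prod k f ih =>
    simp only [subst, depth, add_assoc]
    gcongr
    refine Finset.sup_le fun i _ => (ih i).trans ?_
    gcongr
    exact Finset.le_sup (f := fun i => (f i).depth) (Finset.mem_univ i)

theorem totalDegree_toPoly_le_size [Field K] (F : AlgFormula K σ) :
    F.toPoly.totalDegree ≤ F.size := by
  induction F with
  | var x => simp [toPoly, size]
  | const a => simp [toPoly, size]
  | sum k c f ih =>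
    simp only [toPoly, size]
    refine MvPolynomial.totalDegree_finsetSum_le fun i _ => ?_
    refine (MvPolynomial.totalDegree_mul _ _).trans ?_
    rw [MvPolynomial.totalDegree_C, zero_add]
    exact (ih i).trans <| (Finset.single_le_sum (f := fun i => (f i).size)
      (fun _ _ => Nat.zero_le _) (Finset.mem_univ i)).trans (Nat.le_add_left _ _)
  | prod k f ih =>
    simp only [toPoly, size]
    exact (MvPolynomial.totalDegree_finsetProd _ _).trans <|
      (Finset.sum_le_sum fun i _ => ih i).trans (Nat.le_add_left _ _)

/-- The sum gate computing `a + ∑ i, c i * x i` for finitely many variables. -/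
noncomputable def affine [Fintype σ] [One K] (a : K) (c : σ → K) : AlgFormula K σ :=
  sum (Fintype.card σ) (Fin.cons a fun i => c ((Fintype.equivFin σ).symm i))
    (Fin.cons (const 1) fun i => var ((Fintype.equivFin σ).symm i))

theorem toPoly_affine [Field K] [Fintype σ] (a : K) (c : σ → K) :
    (affine a c).toPoly =
      MvPolynomial.C a + ∑ x, MvPolynomial.C (c x) * MvPolynomial.X x := by
  simp only [affine, toPoly, Fin.sum_univ_succ, Fin.cons_zero, Fin.cons_succ, map_one, mul_one]
  rw [Equiv.sum_comp (Fintype.equivFin σ).symm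
    fun x => MvPolynomial.C (c x) * (MvPolynomial.X x : MvPolynomial σ K)]

theorem size_affine [Field K] [Fintype σ] (a : K) (c : σ → K) :
    (affine a c).size = Fintype.card σ + 2 := by
  simp only [affine, size, Fin.sum_univ_succ, Fin.cons_zero, Fin.cons_succ]
  simp
  omega

theorem depth_affine_le [Field K] [Fintype σ] (a : K) (c : σ → K) :
    (affine a c).depth ≤ 1 := by
  simp only [affine, depth]
  refine (Nat.add_le_add_left (Finset.sup_le fun i _ => ?_) 1).trans (add_zero 1).le
  refine Fin.cases ?_ (fun j => ?_) i <;> simp [depth]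

end AlgFormula

/-! ### Coefficient extraction by interpolation -/

theorem Polynomial.natDegree_aeval_le_totalDegree {K R σ : Type*} [CommSemiring K] [CommSemiring R]
    [Algebra K R] (x : σ → Polynomial R) (hx : ∀ i, (x i).natDegree ≤ 1) (P : MvPolynomial σ K) :
    (MvPolynomial.aeval x P).natDegree ≤ P.totalDegree := by
  rw [MvPolynomial.aeval_def, MvPolynomial.eval₂_eq]
  refine Polynomial.natDegree_sum_le_of_forall_le _ _ fun d hd => ?_
  rw [IsScalarTower.algebraMap_apply K R (Polynomial R), Polynomial.algebraMap_eq]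
  refine (Polynomial.natDegree_C_mul_le _ _).trans ?_
  refine (Polynomial.natDegree_prod_le _ _).trans ?_
  refine le_trans (Finset.sum_le_sum fun i _ => ?_) (MvPolynomial.le_totalDegree hd)
  exact Polynomial.natDegree_pow_le.trans (by simpa using Nat.mul_le_mul_left (d i) (hx i))

/-- Coefficients of polynomials of degree at most `D` are fixed linear combinations of the values
at the points `0, …, D`. -/
theorem exists_coeff_eq_sum_eval {K : Type*} [Field K] [CharZero K] (D : ℕ) (r : ℕ) (hr : r ≤ D) :
    ∃ β : Fin (D + 1) → K, ∀ (R : Type) [CommRing R] [Algebra K R] (Q : Polynomial R),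
      Q.natDegree ≤ D →
        Q.coeff r = ∑ t, algebraMap K R (β t) * Q.eval (algebraMap K R (t : ℕ)) := by
  let V : Matrix (Fin (D + 1)) (Fin (D + 1)) K := Matrix.vandermonde fun t => ((t : ℕ) : K)
  have hV : IsUnit V.det := by
    rw [isUnit_iff_ne_zero, Matrix.det_vandermonde_ne_zero_iff]
    intro i j h
    exact Fin.ext (Nat.cast_injective (R := K) h)
  -- Row `r` of the inverse Vandermonde matrix, independent of `R` and `Q`.
  refine ⟨V⁻¹ ⟨r, by omega⟩, fun R _ _ Q hQ => ?_⟩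
  have hβ : ∀ j : Fin (D + 1), ∑ t, V⁻¹ ⟨r, by omega⟩ t * ((t : ℕ) : K) ^ (j : ℕ) =
      if r = (j : ℕ) then 1 else 0 := fun j => by
    have := congrFun (congrFun (Matrix.nonsing_inv_mul V hV) ⟨r, by omega⟩) j
    rw [Matrix.mul_apply, Matrix.one_apply] at this
    simpa [V, Matrix.vandermonde_apply, Fin.ext_iff] using this
  have he : ∀ x : R, Q.eval x = ∑ j : Fin (D + 1), Q.coeff j * x ^ (j : ℕ) := fun x => by
    rw [Polynomial.eval_eq_sum_range' (Nat.lt_succ_of_le hQ), Finset.sum_range]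
  simp only [he, Finset.mul_sum]
  rw [Finset.sum_comm]
  have : ∀ j : Fin (D + 1), ∑ t, algebraMap K R (V⁻¹ ⟨r, by omega⟩ t) *
      (Q.coeff j * algebraMap K R ((t : ℕ) : K) ^ (j : ℕ)) =
      if r = (j : ℕ) then Q.coeff j else 0 := fun j => by
    rw [← mul_one (Q.coeff j), ← mul_ite_zero, ← map_one (algebraMap K R),
      ← map_zero (algebraMap K R), ← apply_ite (algebraMap K R), ← hβ, map_sum, Finset.mul_sum]
    refine Finset.sum_congr rfl fun t _ => ?_
    simp only [map_mul, map_pow, map_one]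
    ring
  rw [Finset.sum_congr rfl fun j _ => this j, Finset.sum_eq_single ⟨r, by omega⟩]
  · simp
  · intro j _ hj
    rw [if_neg fun h => hj (Fin.ext h.symm)]
  · simp

/-! ### The coefficient of order `ℓ` and the reduction -/

open Matrix in
/-- Perturbing the roots of unity `z i` to first order in the direction `z i * L i`, where `L i` is
the linear form `perturbation k (z i)`, the coefficient of order `ℓ` of the generalized Vandermonde
determinant is a nonzero multiple of the symbolic determinant. -/
theorem coeff_det_perturbed {ℓ m : ℕ} (k : Fin ℓ → Fin m)
    (hk : Function.Injective fun p : Fin ℓ × Fin ℓ => (p.1 : ℕ) + k p.2)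
    (z : Fin ℓ ⊕ Fin m → ℂ) (hz : Function.Injective z) (hzn : ∀ i, z i ^ (ℓ + m) = 1) :
    ∃ v : ℂ, v ≠ 0 ∧
      (Matrix.of fun i j => (Polynomial.C (MvPolynomial.C (z i)) *
          (1 + Polynomial.X * Polynomial.C (perturbation k (z i)))) ^
        Sum.elim (fun b => (k b : ℕ) + (ℓ + m)) (fun b : Fin m => (b.rev : ℕ)) j).det.coeff ℓ =
      MvPolynomial.C v * symbolicDet ℓ := by
  obtain ⟨v, hv, hdet⟩ := det_perturbation_columns k hk z hz hzn
  refine ⟨v, hv, ?_⟩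
  rw [← hdet, det_pow_eq_det_pow_mul_pow_sub_one]
  set x : Fin ℓ ⊕ Fin m → Polynomial (MvPolynomial (Fin ℓ × Fin ℓ) ℂ) := fun i =>
    Polynomial.C (MvPolynomial.C (z i)) *
      (1 + Polynomial.X * Polynomial.C (perturbation k (z i))) with hx
  -- As `z i` is a root of unity, this is `(1 + t L) ^ n - 1`; the geometric sum becomes `n` at `t =
  -- 0`.
  have hpow : ∀ i, x i ^ (ℓ + m) - 1 = Polynomial.X * (Polynomial.C (perturbation k (z i)) *
      ∑ r ∈ Finset.range (ℓ + m),
        (1 + Polynomial.X * Polynomial.C (perturbation k (z i))) ^ r) := fun i => by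
    rw [hx, mul_pow, ← map_pow, ← map_pow, hzn, map_one, map_one, one_mul, ← mul_geom_sum]
    ring
  have hfac : (Matrix.of fun i j => Sum.elim (fun b => x i ^ (k b : ℕ) * (x i ^ (ℓ + m) - 1))
        (fun b : Fin m => x i ^ (b.rev : ℕ)) j) =
      Matrix.of fun i j => Sum.elim (fun _ => Polynomial.X) (fun _ => 1) j *
        (Matrix.of fun i j => Sum.elim (fun b => x i ^ (k b : ℕ) *
          (Polynomial.C (perturbation k (z i)) * ∑ r ∈ Finset.range (ℓ + m),
            (1 + Polynomial.X * Polynomial.C (perturbation k (z i))) ^ r))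
          (fun b : Fin m => x i ^ (b.rev : ℕ)) j :
            Matrix (Fin ℓ ⊕ Fin m) (Fin ℓ ⊕ Fin m) _) i j := by
    ext1 i j
    rcases j with b | b
    · simp only [of_apply, Sum.elim_inl, hpow]
      ring
    · simp only [of_apply, Sum.elim_inr, one_mul]
  rw [hfac, det_mul_row, Fintype.prod_sum_type]
  simp only [Sum.elim_inl, Sum.elim_inr, Finset.prod_const, Finset.card_univ, Fintype.card_fin,
    one_pow, mul_one]
  rw [Polynomial.coeff_X_pow_mul', if_pos le_rfl, Nat.sub_self,
    Polynomial.coeff_zero_eq_eval_zero, ← Polynomial.coe_evalRingHom, RingHom.map_det]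
  congr 1
  ext1 i j
  rcases j with b | b <;> simp [hx, RingHom.mapMatrix_apply, Polynomial.eval_finsetSum]

theorem symbolicDet_ne_zero (ℓ : ℕ) : symbolicDet ℓ ≠ 0 :=
  Matrix.det_mvPolynomialX_ne_zero (Fin ℓ) ℂ

theorem hasFormula_symbolicDet_of_genVandermondeDet {ℓ n : ℕ} {lam : Fin ℓ → ℕ}
    (h : Admissible n lam) {s Δ : ℕ}
    (hF : HasFormula (genVandermondeDet (shiftedExponents n lam)) s Δ) :
    HasFormula (symbolicDet ℓ) (1 + (s + 1) * (s * (s ^ 2 + 2))) (Δ + 2) := by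
  obtain ⟨hℓ, hgap, hlast, hfirst⟩ := h
  obtain ⟨F, hF, hsize, hdepth⟩ := hF
  have hmono : ∀ i j : Fin ℓ, i ≤ j → lam j + (j - i) * (ℓ - 1) ≤ lam i := by
    have aux : ∀ (d : ℕ) (i j : Fin ℓ), (j : ℕ) = i + d → lam j + d * (ℓ - 1) ≤ lam i := by
      intro d
      induction d with
      | zero => intro i j hij; simp [Fin.ext (hij.trans (add_zero _))]
      | succ d ih =>
        intro i j hij
        have h1 := ih i ⟨i + d, by omega⟩ rfl
        have h2 := hgap ⟨i + d, by omega⟩ j (by simpa [add_assoc] using hij)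
        rw [add_mul]
        omega
    exact fun i j hij => aux _ i j (by have := Fin.le_def.1 hij; omega)
  have hlow : ∀ i, ℓ ≤ lam i := fun i =>
    (hlast ⟨ℓ - 1, by omega⟩ (Nat.sub_add_cancel hℓ)).trans <|
      (Nat.le_add_right _ _).trans (hmono i _ (Fin.le_def.2 (by dsimp only; omega)))
  have hhigh : ∀ i, lam i + ℓ ≤ n := fun i =>
    le_trans (Nat.add_le_add_right ((Nat.le_add_right _ _).trans
      (hmono ⟨0, hℓ⟩ i (Fin.le_def.2 (Nat.zero_le _)))) ℓ) (hfirst ⟨0, hℓ⟩ rfl)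
  obtain ⟨m, rfl⟩ : ∃ m, n = ℓ + m :=
    ⟨n - ℓ, by have := hhigh ⟨0, hℓ⟩; omega⟩
  -- From `lam b + (n - 1 - b) = k b + n`; `lam b ≥ ℓ > b` prevents truncation and `lam b ≤ n - ℓ`
  -- gives `k b < m`.
  let k : Fin ℓ → Fin m := fun b => ⟨lam b - 1 - b, by
    have := hlow b; have := hhigh b; omega⟩
  have hk : Function.Injective fun p : Fin ℓ × Fin ℓ => (p.1 : ℕ) + k p.2 := by
    -- Gaps `ℓ - 1` in `lam` become gaps at least `ℓ` in `k` through the term `- b`, exceeding any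
    -- difference of row indices.
    have aux : ∀ a b a' b' : Fin ℓ, (a : ℕ) + k b = a' + k b' → ¬ b < b' := by
      intro a b a' b' he hlt
      have h1 := hmono b b' hlt.le
      have h2 : 1 * (ℓ - 1) ≤ ((b' : ℕ) - b) * (ℓ - 1) :=
        Nat.mul_le_mul_right _ (by have := Fin.lt_def.1 hlt; omega)
      have h3 := Fin.lt_def.1 hlt
      have h4 := hlow b
      have h5 := hlow b'
      have h6 := a.isLt
      have h7 := a'.isLt
      simp only [k] at he
      omega
    rintro ⟨a, b⟩ ⟨a', b'⟩ he
    have hb : b = b' :=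
      le_antisymm (not_lt.1 (aux a' b' a b he.symm)) (not_lt.1 (aux a b a' b' he))
    subst hb
    have ha : a = a' := Fin.ext (Nat.add_right_cancel he)
    rw [ha]
  obtain ⟨ω, hω⟩ : ∃ ω : ℂ, IsPrimitiveRoot ω (ℓ + m) :=
    ⟨_, Complex.isPrimitiveRoot_exp (ℓ + m) (by omega)⟩
  let ζ : Fin (ℓ + m) → ℂ := fun i => ω ^ (i : ℕ)
  have hζ : Function.Injective ζ := fun i j hij => Fin.ext (hω.pow_inj i.isLt j.isLt hij)
  have hζn : ∀ i, ζ i ^ (ℓ + m) = 1 := fun i => by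
    simp only [ζ]
    rw [← pow_mul, mul_comm, pow_mul, hω.pow_eq_one, one_pow]
  obtain ⟨v, hv, hdet⟩ := coeff_det_perturbed k hk (ζ ∘ finSumFinEquiv)
    (hζ.comp finSumFinEquiv.injective) fun i => hζn _
  let x : Fin (ℓ + m) → Polynomial (MvPolynomial (Fin ℓ × Fin ℓ) ℂ) := fun i =>
    Polynomial.C (MvPolynomial.C (ζ i)) *
      (1 + Polynomial.X * Polynomial.C (perturbation k (ζ i)))
  have hcoeff : (MvPolynomial.aeval x F.toPoly).coeff ℓ = MvPolynomial.C v * symbolicDet ℓ := by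
    rw [← hdet, hF, genVandermondeDet, AlgHom.map_det,
      ← Matrix.det_submatrix_equiv_self finSumFinEquiv]
    congr 2
    ext1 i j
    have hexp : ∀ j : Fin ℓ ⊕ Fin m, shiftedExponents (ℓ + m) lam (finSumFinEquiv j) =
        Sum.elim (fun b => (k b : ℕ) + (ℓ + m)) (fun b : Fin m => (b.rev : ℕ)) j := by
      rintro (b | b)
      · have := hlow b
        simp [shiftedExponents, k]
        omega
      · simp [shiftedExponents]
        omega
    simp [hexp, x]
  have hdeg : (MvPolynomial.aeval x F.toPoly).natDegree ≤ s := by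
    refine (Polynomial.natDegree_aeval_le_totalDegree x (fun i => ?_) _).trans
      (F.totalDegree_toPoly_le_size.trans hsize)
    refine (Polynomial.natDegree_C_mul_le _ _).trans ?_
    compute_degree
  -- The nonzero coefficient forces `ℓ ≤ s`, which also bounds the affine forms in terms of `s`
  -- alone.
  have hℓs : ℓ ≤ s := (Polynomial.le_natDegree_of_ne_zero (by
    rw [hcoeff]
    exact mul_ne_zero (by simpa using hv) (symbolicDet_ne_zero ℓ))).trans hdeg
  obtain ⟨β, hβ⟩ := exists_coeff_eq_sum_eval (K := ℂ) s ℓ hℓs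
  let g : Fin (s + 1) → Fin (ℓ + m) → AlgFormula ℂ (Fin ℓ × Fin ℓ) := fun t i =>
    AlgFormula.affine (ζ i) fun p => ζ i * t * ζ i ^ (ℓ + m - 1 - p.1 - k p.2)
  have hg : ∀ t i, (g t i).toPoly = (x i).eval (algebraMap ℂ _ ((t : ℕ) : ℂ)) := fun t i => by
    simp only [g, x, AlgFormula.toPoly_affine, perturbation, MvPolynomial.algebraMap_eq,
      Polynomial.eval_mul, Polynomial.eval_C, Polynomial.eval_add, Polynomial.eval_X,
 mul_add, mul_one, Finset.mul_sum, map_mul, mul_assoc]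
  -- The scalar `v⁻¹` rides on the edges; depth grows by one here and one at the leaves.
  refine ⟨AlgFormula.sum s (fun t => v⁻¹ * β t) fun t => F.subst (g t), ?_, ?_, ?_⟩
  · have heval : ∀ t, (F.subst (g t)).toPoly =
        (MvPolynomial.aeval x F.toPoly).eval (algebraMap ℂ _ ((t : ℕ) : ℂ)) := fun t => by
      rw [AlgFormula.toPoly_subst, funext (hg t), ← Polynomial.coe_evalRingHom,
        MvPolynomial.aeval_def, MvPolynomial.aeval_def, MvPolynomial.eval₂_comp_left]
      congr 1
      ext1 a
      simp [IsScalarTower.algebraMap_apply ℂ (MvPolynomial (Fin ℓ × Fin ℓ) ℂ)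
        (Polynomial (MvPolynomial (Fin ℓ × Fin ℓ) ℂ))]
    have := hβ _ _ hdeg
    simp only [AlgFormula.toPoly, heval, map_mul, mul_assoc, ← Finset.mul_sum]
    rw [MvPolynomial.algebraMap_eq] at this ⊢
    rw [← this, hcoeff, ← mul_assoc, ← map_mul, inv_mul_cancel₀ hv, map_one, one_mul]
  · simp only [AlgFormula.size]
    have hgs : ∀ t i, (g t i).size ≤ s ^ 2 + 2 := fun t i => by
      simp only [g, AlgFormula.size_affine, Fintype.card_prod, Fintype.card_fin, ← sq]
      gcongr
    have := Finset.sum_le_card_nsmul Finset.univ (fun t => (F.subst (g t)).size) _ fun t _ =>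
      (F.size_subst_le (g t) (by omega) (hgs t)).trans (Nat.mul_le_mul_right _ hsize)
    simpa using this
  · simp only [AlgFormula.depth]
    rw [add_comm]
    refine Nat.add_le_add_right (m := Δ + 1) ?_ 1
    refine Finset.sup_le fun t _ => (F.depth_subst_le (g t) fun i =>
      AlgFormula.depth_affine_le _ _).trans (Nat.add_le_add_right hdepth 1)

/-! ### Admissible exponents of quadratic size -/

theorem exists_admissible_le (ℓ : ℕ) (hℓ : 0 < ℓ) : ∃ (n : ℕ) (lam : Fin ℓ → ℕ),
    Admissible n lam ∧ n ≤ 2 * ℓ ^ 2 + ℓ ∧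
      ∀ j : Fin n, shiftedExponents n lam j ≤ 2 * ℓ ^ 2 + ℓ := by
  have hle : ∀ i, ℓ * (ℓ - i) ≤ ℓ ^ 2 := fun i => by
    rw [sq]
    exact Nat.mul_le_mul_left _ (Nat.sub_le _ _)
  refine ⟨ℓ ^ 2 + ℓ, fun i => ℓ * (ℓ - i), ⟨hℓ, fun i j hij => ?_, fun i hi => ?_, fun i hi => ?_⟩,
    by omega, fun j => ?_⟩
  · have := j.isLt
    dsimp only
    rw [show ℓ - (i : ℕ) = (ℓ - j) + 1 by omega, mul_add]
    omega
  · dsimp only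
    rw [show ℓ - (i : ℕ) = 1 by omega, mul_one]
  · exact Nat.add_le_add_right (hle _) _
  · have := hle j
    unfold shiftedExponents
    split
    · dsimp only
      omega
    · omega

theorem mainTheorem3 :
    (∃ (p : Polynomial ℕ) (c : ℕ), ∀ (ℓ n : ℕ) (lam : Fin ℓ → ℕ), Admissible n lam →
      ∀ s Δ : ℕ, HasFormula (genVandermondeDet (shiftedExponents n lam)) s Δ →
        HasFormula (symbolicDet ℓ) (p.eval s) (Δ + c)) ∧
    (∃ q : Polynomial ℕ, ∀ ℓ : ℕ, 0 < ℓ → ∃ (n : ℕ) (lam : Fin ℓ → ℕ),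
      Admissible n lam ∧ n ≤ q.eval ℓ ∧ ∀ j : Fin n, shiftedExponents n lam j ≤ q.eval ℓ) := by
  refine ⟨⟨1 + (Polynomial.X + 1) * (Polynomial.X * (Polynomial.X ^ 2 + 2)), 2,
    fun ℓ n lam h s Δ hF => ?_⟩, ⟨2 * Polynomial.X ^ 2 + Polynomial.X, fun ℓ hℓ => ?_⟩⟩
  · simpa using hasFormula_symbolicDet_of_genVandermondeDet h hF
  · simpa using exists_admissible_le ℓ hℓ
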